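/- Let $d\ge 3$ be odd. A \emph{representation of the Clifford relations} is a $d$-tuple $(\gamma_1,\dots,\gamma_d)$ of Hermitian matrices in $M_n(\mathbb{C})$ with $\gamma_j^2=I$ for all $j$ and $\gamma_j\gamma_k=-\gamma_k\gamma_j$ for $j\ne k$; it is \emph{irreducible} if $n>0$ and $\{0\}$ and $\mathbb{C}^n$ are the only subspaces of $\mathbb{C}^n$ invariant under all $\gamma_j$. Let $\mathcal{C}\ell(d)$ be the complex Clifford algebra with universal generators $e_1,\dots,e_d$ ($e_j^2=1$, $e_je_k=-e_ke_j$ for $j\neq k$). The \emph{Clifford spectrum} $\Lambda(A_1,\dots,A_d)$ of Hermitian matrices $A_1,\dots,A_d\in M_n(\mathbb{C})$ is the set of $\boldsymbol\lambda\in\mathbb{R}^d$ for which $\sum_{j}(A_j-\lambda_j I)\otimes e_j$ is not invertible in $M_n(\mathbb{C})\otimes\mathcal{C}\ell(d)$. For a representation $\rho=(\rho_1,\dots,\rho_d)$ of the Clifford relations put $L^{\rho}_{\boldsymbol\lambda}(A_1,\dots,A_d)=\sum_{j}(A_j-\lambda_j I)\otimes\rho_j$, a Hermitian matrix. The signature $\mathrm{sig}$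 of a Hermitian matrix is the number of its positive eigenvalues minus the number of its negative eigenvalues, counted with multiplicity. Let $\gamma=(\gamma_1,\dots,\gamma_d)$ be an irreducible representation of the Clifford relations. Then $\Lambda(\gamma_1,\dots,\gamma_d)=S^{d-1}$, the unit sphere in $\mathbb{R}^d$. Moreover, with $\rho=\gamma$, $$\mathrm{sig}\left(L^{\rho}_{\boldsymbol\lambda}(\gamma_1,\dots,\gamma_d)\right)=\begin{cases}\dbinom{d-1}{(d-1)/2} & \text{if } |\boldsymbol\lambda|<1,\\[1ex] 0 & \text{if } |\boldsymbol\lambda|>1.\end{cases}$$ The same formula holds for every irreducible representation $\rho$ of the Clifford relations that follows the same sign convention as $\gamma$, that is, such that $\gamma_d=\epsilon\,\gamma_{d-1}\cdots\gamma_2\gamma_1$ and $\rho_d=\epsilon\,\rho_{d-1}\cdots\rho_2\rho_1$ for one and the same scalar $\epsilon\in\mathbb{C}$ (for example $\epsilon=i^{(d-1)/2}$). -/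

import Mathlib

open scoped TensorProduct Kronecker

noncomputable section

namespace CliffordSpec

/-- The quadratic form `∑ j, x_j ^ 2` on `ℂ ^ d`. -/
def stdForm (d : ℕ) : QuadraticForm ℂ (Fin d → ℂ) :=
  QuadraticMap.weightedSumSquares ℂ (fun _ : Fin d => (1 : ℂ))

/-- The complex Clifford algebra with `d` generators. -/
abbrev Cl (d : ℕ) : Type := CliffordAlgebra (stdForm d)

/-- The universal Clifford generators `e_1, …, e_d`. -/
def gen {d : ℕ} (j : Fin d) : Cl d :=
  CliffordAlgebra.ι (stdForm d) (Pi.single j 1)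

theorem gen_sq {d : ℕ} (j : Fin d) : (gen j : Cl d) * gen j = 1 := by
  have h : stdForm d (Pi.single j 1) = 1 := by
    simp [stdForm, QuadraticMap.weightedSumSquares_apply, Pi.single_apply]
  rw [gen, CliffordAlgebra.ι_sq_scalar, h, map_one]

theorem gen_anticomm {d : ℕ} {j k : Fin d} (h : j ≠ k) :
    (gen j : Cl d) * gen k = -(gen k * gen j) := by
  refine eq_neg_of_add_eq_zero_left ?_
  rw [gen, gen, CliffordAlgebra.ι_mul_ι_add_swap]
  have : QuadraticMap.polar (stdForm d) (Pi.single j 1) (Pi.single k 1) = 0 := by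
    simp only [QuadraticMap.polar, stdForm, QuadraticMap.weightedSumSquares_apply, Pi.add_apply,
      ← Finset.sum_sub_distrib]
    refine Finset.sum_eq_zero fun i _ => ?_
    by_cases h1 : i = j <;> by_cases h2 : i = k <;> simp_all
  rw [this, map_zero]

/-- The spectral localizer `∑ j, (A_j - λ_j) ⊗ e_j` in `M_n(ℂ) ⊗ Cℓ(d)`. -/
def universalLocalizer {d n : ℕ} (A : Fin d → Matrix (Fin n) (Fin n) ℂ)
    (x : EuclideanSpace ℝ (Fin d)) : Matrix (Fin n) (Fin n) ℂ ⊗[ℂ] Cl d :=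
  ∑ j, (A j - ((x j : ℝ) : ℂ) • (1 : Matrix (Fin n) (Fin n) ℂ)) ⊗ₜ[ℂ] (gen j : Cl d)

/-- The Clifford spectrum `Λ(A_1, …, A_d)`. -/
def cliffordSpectrum {d n : ℕ} (A : Fin d → Matrix (Fin n) (Fin n) ℂ) :
    Set (EuclideanSpace ℝ (Fin d)) :=
  {x | ¬ IsUnit (universalLocalizer A x)}

/-- A representation of the Clifford relations by `n × n` complex matrices. -/
structure IsCliffordRep {d n : ℕ} (γ : Fin d → Matrix (Fin n) (Fin n) ℂ) : Prop where
  isHermitian : ∀ j, (γ j).IsHermitian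
  mul_self : ∀ j, γ j * γ j = 1
  anticomm : ∀ j k, j ≠ k → γ j * γ k = -(γ k * γ j)

/-- An irreducible representation of the Clifford relations: the representation space `ℂ ^ n` is
nonzero and its only invariant subspaces are the trivial ones. -/
structure IsIrredCliffordRep {d n : ℕ} (γ : Fin d → Matrix (Fin n) (Fin n) ℂ) : Prop
    extends IsCliffordRep γ where
  pos : 0 < n
  irred : ∀ W : Submodule ℂ (Fin n → ℂ),
    (∀ j, ∀ v ∈ W, Matrix.mulVec (γ j) v ∈ W) → W = ⊥ ∨ W = ⊤

/-- The sign relation `γ_d = ε γ_{d-1} ⋯ γ_2 γ_1`, in which `γ_d` is the last entry of the tuple. -/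
def HasCliffordSign {d n : ℕ} (γ : Fin d → Matrix (Fin n) (Fin n) ℂ) (ε : ℂ) : Prop :=
  ∀ j : Fin d, (j : ℕ) + 1 = d → γ j = ε • ((List.ofFn γ).dropLast.reverse).prod

/-- The localizer `∑ j, (A_j - λ_j) ⊗ ρ_j` as a matrix, with the generators represented by `ρ`. -/
def localizer {d n r : ℕ} (ρ : Fin d → Matrix (Fin r) (Fin r) ℂ)
    (A : Fin d → Matrix (Fin n) (Fin n) ℂ) (x : EuclideanSpace ℝ (Fin d)) :
    Matrix (Fin n × Fin r) (Fin n × Fin r) ℂ :=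
  ∑ j, (A j - ((x j : ℝ) : ℂ) • (1 : Matrix (Fin n) (Fin n) ℂ)) ⊗ₖ ρ j

theorem localizer_isHermitian {d n r : ℕ} {ρ : Fin d → Matrix (Fin r) (Fin r) ℂ}
    {A : Fin d → Matrix (Fin n) (Fin n) ℂ} (hρ : ∀ j, (ρ j).IsHermitian)
    (hA : ∀ j, (A j).IsHermitian) (x : EuclideanSpace ℝ (Fin d)) :
    (localizer ρ A x).IsHermitian := by
  unfold localizer Matrix.IsHermitian
  rw [Matrix.conjTranspose_sum]
  refine Finset.sum_congr rfl fun j _ => ?_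
  rw [Matrix.conjTranspose_kronecker, Matrix.conjTranspose_sub, Matrix.conjTranspose_smul,
    Matrix.conjTranspose_one, (hρ j).eq, (hA j).eq]
  simp

/-- The signature of a Hermitian matrix: the number of positive eigenvalues minus the number of
negative eigenvalues, counted with multiplicity. -/
def signature {m : Type} [Fintype m] [DecidableEq m] (M : Matrix m m ℂ)
    (hM : M.IsHermitian) : ℤ :=
  (Finset.card {i | 0 < hM.eigenvalues i} : ℤ) - (Finset.card {i | hM.eigenvalues i < 0} : ℤ)

end CliffordSpec

end

/-!
For commuting realisations `g`, `e` of the Clifford relations, such as `γ i ⊗ 1` and `1 ⊗ ρ i`, the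
involutions `g i * e i` commute, so they diagonalise jointly with eigenvalues in `{1, -1} ^ d`. As
`d` is odd, the eigenvalues of `S = ∑ i, g i * e i` are odd integers. With `v = ∑ i, x i • e i` and
`q = ∑ i, x i ^ 2`, the pencil `a • S - v` divides `q ^ 2 • ((a² S² + q)² - 4 a⁴ S²)`, whose
eigenvalues `q² (a² ((s - 1)² - 1) + q) (a² ((s + 1)² - 1) + q)` with `s` odd are nonzero when
`q ≠ 0` and `a² ≠ q`. Hence the localizer `S - v` is invertible off the unit sphere, and its
signature is constant inside the sphere and, along the deformation `a : 1 → 0`, agrees outside with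
that of `-v`, which has trace zero and square `q`. At `x = 0` irreducibility fixes the product of
the `g i * e i` to be a scalar and the dimension to be `2 ^ ((d - 1) / 2)`, so traces of polynomials
in `S` are explicit; they give the multiplicities of its eigenvalues, and the signature is an
alternating sum of binomial coefficients. On the sphere the localizer cannot be invertible, since
the signature changes along the ray through `x`.
-/

namespace CliffordSpec

/-! ### Joint functional calculus of commuting involutions -/

section SignCoord

variable {ι : Type*} [DecidableEq ι] {𝕜 : Type*} [CommRing 𝕜]

/-- The `i`-th coordinate sign. A subset `B` of `ι` encodes the sign vector in `{1, -1} ^ ι` whose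
negative entries are those in `B`, so these functions are the coordinates on the joint spectrum of
commuting involutions indexed by `ι`. -/
def signCoord (𝕜 : Type*) [CommRing 𝕜] (i : ι) (B : Finset ι) : 𝕜 :=
  if i ∈ B then -1 else 1

theorem signCoord_mul_self (i : ι) : signCoord 𝕜 i * signCoord 𝕜 i = 1 := by
  funext B
  by_cases h : i ∈ B <;> simp [signCoord, h]

theorem exists_signCoord_ne [NeZero (2 : 𝕜)] {B C : Finset ι} (h : B ≠ C) :
    ∃ i, signCoord 𝕜 i B ≠ signCoord 𝕜 i C := by
  obtain ⟨i, hi⟩ : ∃ i, ¬(i ∈ B ↔ i ∈ C) := by simpa [Finset.ext_iff] using h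
  have two_ne : (-1 : 𝕜) ≠ 1 := fun h => NeZero.ne (2 : 𝕜) (by linear_combination -h)
  refine ⟨i, ?_⟩
  by_cases hB : i ∈ B <;> by_cases hC : i ∈ C <;> simp_all [signCoord, two_ne.symm]

variable [Fintype ι]

theorem sum_signCoord_apply (B : Finset ι) :
    (∑ i, signCoord 𝕜 i) B = Fintype.card ι - 2 * (B.card : 𝕜) := by
  have h (i : ι) : signCoord 𝕜 i B = 1 - 2 * if i ∈ B then 1 else 0 := by
    unfold signCoord
    split_ifs <;> ring
  simp [h, mul_comm]

theorem prod_signCoord_apply (B : Finset ι) : (∏ i, signCoord 𝕜 i) B = (-1) ^ B.card := by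
  simp [signCoord]

end SignCoord

section Calculus

variable {ι : Type*} [Fintype ι] [DecidableEq ι] {𝕜 : Type*} [Field 𝕜]

theorem exists_algHom_eq_sum_smul {I R : Type*} [Fintype I] [Ring R] [Algebra 𝕜 R]
    {P : I → R} (hP : CompleteOrthogonalIdempotents P) :
    ∃ Φ : (I → 𝕜) →ₐ[𝕜] R, ∀ f, Φ f = ∑ i, f i • P i := by
  classical
  exact ⟨AlgHom.ofLinearMap (Fintype.linearCombination 𝕜 P)
    (by simp [Fintype.linearCombination_apply, hP.complete])
    (fun f g => by
      simp [Fintype.linearCombination_apply, Finset.sum_mul_sum, hP.mul_eq, mul_comm, smul_smul]),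
    fun f => rfl⟩

/-- The idempotent of a commutative algebra onto the part where each involution `t i` acts by
`signCoord 𝕜 i B`. -/
def jointProj (𝕜 : Type*) [Field 𝕜] {R : Type*} [CommRing R] [Algebra 𝕜 R] (t : ι → R)
    (B : Finset ι) : R :=
  ∏ i, (2⁻¹ : 𝕜) • (1 + signCoord 𝕜 i B • t i)

variable {R : Type*} [CommRing R] [Algebra 𝕜 R] {t : ι → R}

theorem mul_jointProj {i : ι} (ht : t i * t i = 1) (B : Finset ι) :
    t i * jointProj 𝕜 t B = signCoord 𝕜 i B • jointProj 𝕜 t B := by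
  have h : t i * (1 + signCoord 𝕜 i B • t i) =
      signCoord 𝕜 i B • (1 + signCoord 𝕜 i B • t i) := by
    have hs := congrFun (signCoord_mul_self (𝕜 := 𝕜) i) B
    rw [Pi.mul_apply, Pi.one_apply] at hs
    rw [mul_add, mul_one, mul_smul_comm, ht, smul_add, smul_smul, hs, one_smul, add_comm]
  rw [jointProj, ← Finset.mul_prod_erase _ _ (Finset.mem_univ i), ← mul_assoc, mul_smul_comm, h,
    smul_comm, smul_mul_assoc]

variable [NeZero (2 : 𝕜)]

theorem sum_jointProj (t : ι → R) : ∑ B, jointProj 𝕜 t B = 1 := by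
  have h (i : ι) : (2⁻¹ : 𝕜) • (1 - t i) + (2⁻¹ : 𝕜) • (1 + t i) = 1 := by
    rw [← smul_add, sub_add_add_cancel, smul_add, ← add_smul, ← two_mul,
      mul_inv_cancel₀ (NeZero.ne 2), one_smul]
  have hB (B : Finset ι) : jointProj 𝕜 t B =
      (∏ i ∈ B, (2⁻¹ : 𝕜) • (1 - t i)) * ∏ i ∈ Bᶜ, (2⁻¹ : 𝕜) • (1 + t i) := by
    rw [jointProj, ← Finset.prod_mul_prod_compl B]
    congr 1 <;> refine Finset.prod_congr rfl fun i hi => ?_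
    · simp [signCoord, hi, sub_eq_add_neg]
    · simp [signCoord, Finset.mem_compl.1 hi]
  simp only [hB, ← Fintype.prod_add, h, Finset.prod_const_one]

theorem completeOrthogonalIdempotents_jointProj (ht : ∀ i, t i * t i = 1) :
    CompleteOrthogonalIdempotents (jointProj 𝕜 t) := by
  refine CompleteOrthogonalIdempotents.iff_ortho_complete.2 ⟨fun B C hBC => ?_, sum_jointProj t⟩
  obtain ⟨i, hi⟩ := exists_signCoord_ne (𝕜 := 𝕜) hBC
  have h : signCoord 𝕜 i B • (jointProj 𝕜 t B * jointProj 𝕜 t C) =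
      signCoord 𝕜 i C • (jointProj 𝕜 t B * jointProj 𝕜 t C) := by
    rw [← smul_mul_assoc, ← mul_jointProj (ht i), ← mul_smul_comm, ← mul_jointProj (ht i),
      mul_left_comm, mul_assoc]
  rw [← sub_eq_zero, ← sub_smul] at h
  exact (smul_eq_zero.1 h).resolve_left (sub_ne_zero.2 hi)

end Calculus

section ExistsAlgHom

variable {ι : Type*} [Finite ι] [DecidableEq ι] {𝕜 : Type*} [Field 𝕜] [NeZero (2 : 𝕜)]

theorem exists_algHom_signCoord_of_comm {R : Type*} [CommRing R] [Algebra 𝕜 R] {t : ι → R}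
    (ht : ∀ i, t i * t i = 1) :
    ∃ Φ : (Finset ι → 𝕜) →ₐ[𝕜] R, ∀ i, Φ (signCoord 𝕜 i) = t i := by
  have := Fintype.ofFinite ι
  obtain ⟨Φ, hΦ⟩ := exists_algHom_eq_sum_smul (𝕜 := 𝕜)
    (completeOrthogonalIdempotents_jointProj (𝕜 := 𝕜) ht)
  refine ⟨Φ, fun i => ?_⟩
  simp only [hΦ, ← mul_jointProj (ht i), ← Finset.mul_sum, sum_jointProj, mul_one]

theorem exists_algHom_signCoord {A : Type*} [Ring A] [Algebra 𝕜 A] {T : ι → A}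
    (hT : ∀ i, T i * T i = 1) (hcomm : ∀ i j, Commute (T i) (T j)) :
    ∃ Φ : (Finset ι → 𝕜) →ₐ[𝕜] A, ∀ i, Φ (signCoord 𝕜 i) = T i := by
  have hR : IsMulCommutative (Algebra.adjoin 𝕜 (Set.range T)) := by
    refine Algebra.isMulCommutative_adjoin 𝕜 ?_
    rintro _ ⟨i, rfl⟩ _ ⟨j, rfl⟩
    exact hcomm i j
  let _ : CommRing (Algebra.adjoin 𝕜 (Set.range T)) :=
    { (inferInstance : Ring (Algebra.adjoin 𝕜 (Set.range T))) with mul_comm := hR.is_comm.comm }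
  obtain ⟨Φ, hΦ⟩ := exists_algHom_signCoord_of_comm (𝕜 := 𝕜)
    (t := fun i => (⟨T i, Algebra.subset_adjoin ⟨i, rfl⟩⟩ : Algebra.adjoin 𝕜 (Set.range T)))
    fun i => Subtype.ext (hT i)
  exact ⟨(Algebra.adjoin 𝕜 (Set.range T)).val.comp Φ, fun i => by simp [hΦ]⟩

end ExistsAlgHom

/-! ### Clifford systems -/

/-- A family of pairwise anticommuting involutions in a ring, that is, a realisation of the Clifford
relations. -/
structure IsCliffordSystem {ι A : Type*} [Ring A] (e : ι → A) : Prop where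
  mul_self : ∀ i, e i * e i = 1
  anticomm : ∀ i j, i ≠ j → e i * e j = -(e j * e i)

/-- Two realisations of the Clifford relations that commute with each other, such as `γ i ⊗ 1` and
`1 ⊗ ρ i`. The localizer of `γ` formed with `ρ` is assembled from such a pair. -/
structure IsCliffordPair {ι A : Type*} [Ring A] (g e : ι → A) : Prop where
  left : IsCliffordSystem g
  right : IsCliffordSystem e
  comm : ∀ i j, Commute (g i) (e j)

theorem IsCliffordSystem.map {ι A B : Type*} [Ring A] [Ring B] {e : ι → A}
    (he : IsCliffordSystem e) (f : A →+* B) : IsCliffordSystem (f ∘ e) where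
  mul_self i := by simp [← map_mul, he.mul_self]
  anticomm i j hij := by simp [← map_mul, he.anticomm i j hij]

theorem IsCliffordSystem.sum_smul_mul_self {ι A 𝕜 : Type*} [Ring A] [CommRing 𝕜] [Algebra 𝕜 A]
    {e : ι → A} (he : IsCliffordSystem e) (c : ι → 𝕜) (s : Finset ι) :
    (∑ i ∈ s, c i • e i) * ∑ i ∈ s, c i • e i = (∑ i ∈ s, c i ^ 2) • (1 : A) := by
  classical
  induction s using Finset.induction_on with
  | empty => simp
  | insert a s ha ih =>
    have hanti : c a • e a * ∑ i ∈ s, c i • e i = -((∑ i ∈ s, c i • e i) * c a • e a) := by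
      rw [Finset.mul_sum, Finset.sum_mul, ← Finset.sum_neg_distrib]
      refine Finset.sum_congr rfl fun i hi => ?_
      rw [smul_mul_smul_comm, smul_mul_smul_comm, he.anticomm a i (ne_of_mem_of_not_mem hi ha).symm,
        smul_neg, mul_comm]
    have hsq : c a • e a * c a • e a = c a ^ 2 • (1 : A) := by
      rw [smul_mul_smul_comm, he.mul_self, pow_two]
    rw [Finset.sum_insert ha, Finset.sum_insert ha, add_mul, mul_add, mul_add, ih, hanti, hsq,
      add_smul]
    abel

namespace IsCliffordPair

variable {ι A : Type*} [Ring A] {g e : ι → A}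

theorem symm (h : IsCliffordPair g e) : IsCliffordPair e g :=
  ⟨h.right, h.left, fun i j => (h.comm j i).symm⟩

theorem map {B : Type*} [Ring B] (h : IsCliffordPair g e) (f : A →+* B) :
    IsCliffordPair (f ∘ g) (f ∘ e) :=
  ⟨h.left.map f, h.right.map f, fun i j => (h.comm i j).map f⟩

theorem mul_mul_self (h : IsCliffordPair g e) (i : ι) : g i * e i * (g i * e i) = 1 := by
  rw [(h.comm i i).symm.mul_mul_mul_comm, h.left.mul_self, h.right.mul_self, one_mul]

theorem left_mul_self (h : IsCliffordPair g e) (i : ι) : g i * (g i * e i) = g i * e i * g i := by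
  rw [mul_assoc, (h.comm i i).eq]

theorem left_mul_of_ne (h : IsCliffordPair g e) {i j : ι} (hij : i ≠ j) :
    g i * (g j * e j) = -(g j * e j * g i) := by
  rw [← mul_assoc, h.left.anticomm i j hij, mul_assoc (g j), ← (h.comm i j).eq, ← mul_assoc,
    neg_mul]

theorem commute_mul (h : IsCliffordPair g e) (i j : ι) : Commute (g i * e i) (g j * e j) := by
  rcases eq_or_ne i j with rfl | hij
  · exact Commute.refl _
  · rw [Commute, SemiconjBy, (h.comm i j).symm.mul_mul_mul_comm, (h.comm j i).symm.mul_mul_mul_comm,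
      h.left.anticomm i j hij, h.right.anticomm i j hij, neg_mul_neg]

variable [Fintype ι] {𝕜 : Type*} [CommRing 𝕜] [Algebra 𝕜 A]

theorem left_mul_sum_add (h : IsCliffordPair g e) (i : ι) :
    g i * ∑ j, g j * e j + (∑ j, g j * e j) * g i = 2 * e i := by
  classical
  rw [Finset.mul_sum, Finset.sum_mul, ← Finset.sum_add_distrib,
    Finset.sum_eq_single i (fun j _ hj => by rw [h.left_mul_of_ne hj.symm, neg_add_cancel])
      (by simp), ← h.left_mul_self, ← mul_assoc, h.left.mul_self, one_mul, two_mul]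

theorem sum_smul_left_mul_sum_add (h : IsCliffordPair g e) (x : ι → 𝕜) :
    (∑ i, x i • g i) * ∑ j, g j * e j + (∑ j, g j * e j) * ∑ i, x i • g i =
      2 * ∑ i, x i • e i := by
  rw [Finset.sum_mul, Finset.mul_sum (f := fun i => x i • g i), ← Finset.sum_add_distrib,
    Finset.mul_sum]
  simp only [smul_mul_assoc, mul_smul_comm, ← smul_add, h.left_mul_sum_add]

end IsCliffordPair

theorem list_prod_mul_reverse_prod {M : Type*} [Monoid M] {l : List M}
    (h : ∀ a ∈ l, a * a = 1) : l.prod * l.reverse.prod = 1 := by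
  induction l with
  | nil => simp
  | cons a l ih =>
    rw [List.forall_mem_cons] at h
    rw [List.reverse_cons, List.prod_append, List.prod_cons, List.prod_singleton, mul_assoc,
      ← mul_assoc l.prod, ih h.2, one_mul, h.1]

theorem list_prod_mulLeft_mul_mulRight_apply {R A : Type*} [CommSemiring R] [Semiring A]
    [Algebra R A] (l : List A) (X : A) :
    (l.map fun a => LinearMap.mulLeft R a * LinearMap.mulRight R a).prod X =
      l.prod * X * l.reverse.prod := by
  induction l with
  | nil => simp
  | cons a l ih => simp [ih, mul_assoc]

namespace IsCliffordSystem

variable {ι A : Type*} [Ring A] {e : ι → A}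

theorem mul_list_prod [DecidableEq ι] (he : IsCliffordSystem e) (i : ι) {l : List ι}
    (hl : l.Nodup) :
    e i * (l.map e).prod = (-1) ^ (l.erase i).length * ((l.map e).prod * e i) := by
  induction l with
  | nil => simp
  | cons j l ih =>
    obtain ⟨hj, hl'⟩ := List.nodup_cons.1 hl
    rw [List.map_cons, List.prod_cons]
    rcases eq_or_ne i j with rfl | hij
    · rw [List.erase_cons_head, mul_assoc (e i),
        ← ((Commute.neg_one_right (e i)).pow_right _).left_comm, ih hl',
        List.erase_of_not_mem hj]
    · rw [← mul_assoc, he.anticomm i j hij, neg_mul, mul_assoc, ih hl',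
        ((Commute.neg_one_right (e j)).pow_right _).left_comm,
        List.erase_cons_tail (by simpa using hij.symm), List.length_cons, pow_succ',
        neg_one_mul, neg_mul, mul_assoc (e j)]

theorem list_prod_mul_self (he : IsCliffordSystem e) {l : List ι} (hl : l.Nodup) :
    (l.map e).prod * (l.map e).prod = (-1) ^ l.length.choose 2 := by
  classical
  induction l with
  | nil => simp
  | cons a l ih =>
    obtain ⟨ha, hl⟩ := List.nodup_cons.1 hl
    have hcomm := he.mul_list_prod a hl
    rw [List.erase_of_not_mem ha] at hcomm
    rw [List.map_cons, List.prod_cons]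
    calc e a * (l.map e).prod * (e a * (l.map e).prod)
        = (-1) ^ l.length * ((l.map e).prod * e a) * (e a * (l.map e).prod) :=
          congrArg (· * _) hcomm
      _ = (-1) ^ l.length * ((l.map e).prod * (e a * e a) * (l.map e).prod) := by
          simp only [mul_assoc]
      _ = (-1) ^ (a :: l).length.choose 2 := by
          rw [he.mul_self, mul_one, ih hl, ← pow_add, List.length_cons,
            Nat.choose_succ_succ' l.length 1, Nat.choose_one_right]

theorem ofFn_prod_mul_self {m : ℕ} {e : Fin (2 * m + 1) → A} (he : IsCliffordSystem e) :
    (List.ofFn e).prod * (List.ofFn e).prod = (-1) ^ m := by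
  have hchoose : (2 * m + 1).choose 2 = 2 * (m * m) + m := by
    rw [Nat.choose_two_right, Nat.add_sub_cancel]
    exact Nat.div_eq_of_eq_mul_left two_pos (by ring)
  rw [List.ofFn_eq_map, he.list_prod_mul_self (List.nodup_finRange _), List.length_finRange,
    hchoose, pow_add, pow_mul]
  simp

theorem commute_ofFn_prod {m : ℕ} {e : Fin (2 * m + 1) → A} (he : IsCliffordSystem e)
    (i : Fin (2 * m + 1)) : Commute (e i) (List.ofFn e).prod := by
  have h := he.mul_list_prod i (List.nodup_finRange _)
  rwa [List.length_erase_of_mem (List.mem_finRange i), List.length_finRange, Nat.add_sub_cancel,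
    pow_mul, neg_one_sq, one_pow, one_mul, ← List.ofFn_eq_map] at h

theorem isCliffordPair_mulLeft_mulRight {𝕜 : Type*} [CommRing 𝕜] [Algebra 𝕜 A]
    (he : IsCliffordSystem e) :
    IsCliffordPair (A := Module.End 𝕜 A) (fun i => LinearMap.mulLeft 𝕜 (e i))
      (fun i => LinearMap.mulRight 𝕜 (e i)) where
  left :=
    { mul_self := fun i => by ext X; simp [← mul_assoc, he.mul_self]
      anticomm := fun i j hij => by ext X; simp [← mul_assoc, he.anticomm i j hij] }
  right :=
    { mul_self := fun i => by ext X; simp [mul_assoc, he.mul_self]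
      anticomm := fun i j hij => by ext X; simp [mul_assoc, he.anticomm i j hij] }
  comm i j := by
    ext X
    simp [mul_assoc]

theorem isCliffordPair_tmul {𝕜 B : Type*} [CommRing 𝕜] [Algebra 𝕜 A] [Ring B] [Algebra 𝕜 B]
    {e' : ι → B} (he : IsCliffordSystem e) (he' : IsCliffordSystem e') :
    IsCliffordPair (fun i => e i ⊗ₜ[𝕜] (1 : B)) (fun i => (1 : A) ⊗ₜ[𝕜] e' i) where
  left := he.map (Algebra.TensorProduct.includeLeftRingHom : A →+* A ⊗[𝕜] B)
  right := he'.map (Algebra.TensorProduct.includeRight : B →ₐ[𝕜] A ⊗[𝕜] B).toRingHom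
  comm i j := by simp [Commute, SemiconjBy]

end IsCliffordSystem

theorem map_prod_signCoord {d : ℕ} {𝕜 A : Type*} [Field 𝕜] [Ring A] [Algebra 𝕜 A]
    {Φ : (Finset (Fin d) → 𝕜) →ₐ[𝕜] A} {T : Fin d → A} (hΦ : ∀ i, Φ (signCoord 𝕜 i) = T i) :
    Φ (∏ i, signCoord 𝕜 i) = (List.ofFn T).prod := by
  rw [← List.prod_ofFn, map_list_prod, List.map_ofFn]
  exact congrArg _ (congrArg _ (funext hΦ))

/-! ### Invertibility of the pencil -/

/-- The element `a ∑ i, g i e i - ∑ i, x i e i`. Its value at `a = 1` is the localizer of `g` formed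
with `e`; the parameter `a` makes it possible to deform the localizer to `-∑ i, x i e i`. -/
def cliffordPencil {ι A 𝕜 : Type*} [Fintype ι] [Ring A] [CommRing 𝕜] [Algebra 𝕜 A] (g e : ι → A)
    (a : 𝕜) (x : ι → 𝕜) : A :=
  a • ∑ i, g i * e i - ∑ i, x i • e i

theorem sq_mul_sq_sub_one_add_ne_zero {𝕜 : Type*} [Field 𝕜] [LinearOrder 𝕜] [IsStrictOrderedRing 𝕜]
    {a q : 𝕜} (hq : 0 < q) (haq : a ^ 2 ≠ q) {n : ℤ} (hn : Even n) :
    a ^ 2 * ((n : 𝕜) ^ 2 - 1) + q ≠ 0 := by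
  rcases eq_or_ne n 0 with rfl | hn0
  · intro h0
    exact haq (by push_cast at h0; linear_combination -h0)
  · have hn1 : (1 : ℤ) ≤ n ^ 2 := Int.add_one_le_of_lt (sq_pos_of_ne_zero hn0)
    have hn1' : (1 : 𝕜) ≤ (n : 𝕜) ^ 2 := by exact_mod_cast hn1
    have := mul_nonneg (sq_nonneg a) (sub_nonneg.2 hn1')
    linarith

namespace IsCliffordPair

section Square

variable {ι A : Type*} [Ring A] {g e : ι → A} [Fintype ι] {𝕜 : Type*} [CommRing 𝕜] [Algebra 𝕜 A]

theorem commute_sum_smul (h : IsCliffordPair g e) (x : ι → 𝕜) :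
    Commute (∑ i, x i • g i) (∑ i, x i • e i) :=
  Commute.sum_left _ _ _ fun i _ => Commute.sum_right _ _ _ fun j _ =>
    ((h.comm i j).smul_left _).smul_right _

theorem cliffordPencil_mul_self (h : IsCliffordPair g e) (a : 𝕜) (x : ι → 𝕜) :
    cliffordPencil g e a x * cliffordPencil g e a x =
      a ^ 2 • ((∑ i, g i * e i) * ∑ i, g i * e i) - (2 * a) • ∑ i, x i • g i +
        (∑ i, x i ^ 2) • (1 : A) := by
  have hanti := h.symm.sum_smul_left_mul_sum_add x
  simp only [← (h.comm _ _).eq] at hanti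
  have hsq := h.right.sum_smul_mul_self x Finset.univ
  rw [cliffordPencil]
  generalize ∑ i, g i * e i = S at *
  generalize ∑ i, x i • e i = v at *
  have hvS : v * S = (2 : 𝕜) • ∑ i, x i • g i - S * v := by
    rw [eq_sub_iff_add_eq, hanti, ofNat_smul_eq_nsmul, two_nsmul, two_mul]
  rw [mul_sub, sub_mul, sub_mul, hsq, smul_mul_smul_comm, mul_smul_comm, smul_mul_assoc, hvS]
  module

theorem commute_sum_sum_smul_mul (h : IsCliffordPair g e) (x : ι → 𝕜) :
    Commute (∑ i, g i * e i) ((∑ i, x i • g i) * ∑ i, x i • e i) := by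
  have hw := h.sum_smul_left_mul_sum_add x
  have hv := h.symm.sum_smul_left_mul_sum_add x
  simp only [← (h.comm _ _).eq] at hv
  have hww := h.left.sum_smul_mul_self x Finset.univ
  have hvv := h.right.sum_smul_mul_self x Finset.univ
  generalize ∑ i, g i * e i = S at *
  generalize ∑ i, x i • e i = v at *
  generalize ∑ i, x i • g i = w at *
  calc S * (w * v) = (2 * v - w * S) * v := by rw [← hw]; noncomm_ring
    _ = 2 * (w * w) - w * (S * v) := by rw [sub_mul, mul_assoc 2, hvv, hww, mul_assoc]
    _ = w * (2 * w - S * v) := by noncomm_ring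
    _ = w * v * S := by rw [← hv]; noncomm_ring

theorem cliffordPencil_mul (h : IsCliffordPair g e) (a : 𝕜) (x : ι → 𝕜) :
    cliffordPencil g e a x * ((∑ i, x i ^ 2) • cliffordPencil g e a x -
        (2 * a) • ((∑ i, x i • g i) * ∑ i, x i • e i)) =
      (∑ i, x i ^ 2) • (a ^ 2 • ((∑ i, g i * e i) * ∑ i, g i * e i) + (∑ i, x i ^ 2) • (1 : A)) -
        (2 * a ^ 2) • ((∑ i, g i * e i) * ((∑ i, x i • g i) * ∑ i, x i • e i)) := by
  have hLN : cliffordPencil g e a x * ((∑ i, x i • g i) * ∑ i, x i • e i) =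
      a • ((∑ i, g i * e i) * ((∑ i, x i • g i) * ∑ i, x i • e i)) -
        (∑ i, x i ^ 2) • ∑ i, x i • g i := by
    rw [cliffordPencil, sub_mul, smul_mul_assoc, (h.commute_sum_smul x).eq,
      ← mul_assoc (∑ i, x i • e i), h.right.sum_smul_mul_self, smul_mul_assoc, one_mul]
  rw [mul_sub, mul_smul_comm, mul_smul_comm, h.cliffordPencil_mul_self, hLN]
  module

theorem commute_cliffordPencil (h : IsCliffordPair g e) (a : 𝕜) (x : ι → 𝕜) :
    Commute (cliffordPencil g e a x) ((∑ i, x i • g i) * ∑ i, x i • e i) :=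
  ((h.commute_sum_sum_smul_mul x).smul_left a).sub_left
    ((h.commute_sum_smul x).symm.mul_right (Commute.refl _))

theorem isUnit_cliffordPencil_of_isUnit (h : IsCliffordPair g e) {a : 𝕜} {x : ι → 𝕜}
    (hu : IsUnit ((∑ i, x i ^ 2) ^ 2 •
      ((a ^ 2 • (∑ i, g i * e i) ^ 2 + (∑ i, x i ^ 2) • (1 : A)) ^ 2 -
        (4 * a ^ 4) • (∑ i, g i * e i) ^ 2))) :
    IsUnit (cliffordPencil g e a x) := by
  have hLN := h.commute_cliffordPencil a x
  have hSN := h.commute_sum_sum_smul_mul x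
  have hL := h.cliffordPencil_mul a x
  have hNN : (∑ i, x i • g i) * (∑ i, x i • e i) * ((∑ i, x i • g i) * ∑ i, x i • e i) =
      (∑ i, x i ^ 2) ^ 2 • (1 : A) := by
    rw [(h.commute_sum_smul x).symm.mul_mul_mul_comm, h.left.sum_smul_mul_self,
      h.right.sum_smul_mul_self, smul_mul_smul_comm, mul_one, pow_two]
  generalize (∑ i, x i • g i) * ∑ i, x i • e i = N at *
  generalize ∑ i, g i * e i = S at *
  generalize ∑ i, x i ^ 2 = q at *
  generalize cliffordPencil g e a x = L at *
  set U := q • (a ^ 2 • (S * S) + q • (1 : A))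
  set W := (2 * a ^ 2) • (S * N)
  have hUW : Commute U W := by
    have hS : Commute S (S * N) := (Commute.refl S).mul_right hSN
    exact ((((hS.mul_left hS).smul_left _).add_left ((Commute.one_left _).smul_left q)).smul_left
      q).smul_right _
  have hprod : (U - W) * (U + W) = q ^ 2 • ((a ^ 2 • S ^ 2 + q • 1) ^ 2 - (4 * a ^ 4) • S ^ 2) := by
    have hUU : U * U = q ^ 2 • (a ^ 2 • S ^ 2 + q • 1) ^ 2 := by
      rw [← pow_two, ← smul_pow, pow_two S]
    have hWW : W * W = (4 * a ^ 4 * q ^ 2) • S ^ 2 := by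
      rw [smul_mul_smul_comm, hSN.symm.mul_mul_mul_comm, hNN, mul_smul_comm, mul_one, smul_smul,
        pow_two S]
      ring_nf
    rw [sub_mul, mul_add, mul_add, hUW.eq, hUU, hWW]
    module
  have hcomm : Commute (U - W) (U + W) :=
    (Commute.refl U).add_right hUW |>.sub_left (hUW.symm.add_right (Commute.refl W))
  rw [← hprod, hcomm.isUnit_mul_iff, ← hL] at hu
  have hM : Commute L (q • L - (2 * a) • N) :=
    ((Commute.refl L).smul_right q).sub_right (hLN.smul_right _)
  exact (hM.isUnit_mul_iff.1 hu.1).1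

end Square

section Invertible

variable {ι A : Type*} [Ring A] {g e : ι → A} {𝕜 : Type*} [Field 𝕜] [Algebra 𝕜 A]

theorem exists_algHom_signCoord [Finite ι] [DecidableEq ι] [NeZero (2 : 𝕜)]
    (h : IsCliffordPair g e) :
    ∃ Φ : (Finset ι → 𝕜) →ₐ[𝕜] A, ∀ i, Φ (signCoord 𝕜 i) = g i * e i :=
  CliffordSpec.exists_algHom_signCoord h.mul_mul_self h.commute_mul

variable [Fintype ι] [LinearOrder 𝕜] [IsStrictOrderedRing 𝕜]

theorem exists_algHom_eq_sum_mul (h : IsCliffordPair g e) (hodd : Odd (Fintype.card ι)) :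
    ∃ (Φ : (Finset ι → 𝕜) →ₐ[𝕜] A) (n : Finset ι → ℤ), (∀ B, Odd (n B)) ∧
      Φ (fun B => n B) = ∑ i, g i * e i := by
  classical
  obtain ⟨Φ, hΦ⟩ := h.exists_algHom_signCoord (𝕜 := 𝕜)
  refine ⟨Φ, fun B => Fintype.card ι - 2 * B.card, fun B => ?_, ?_⟩
  · exact Odd.sub_even (by exact_mod_cast hodd) (even_two_mul _)
  · simp only [← hΦ, ← map_sum]
    congr 1
    funext B
    rw [sum_signCoord_apply]
    push_cast
    rfl

theorem isUnit_smul_sum_mul (h : IsCliffordPair g e) (hodd : Odd (Fintype.card ι)) {a : 𝕜}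
    (ha : a ≠ 0) : IsUnit (a • ∑ i, g i * e i) := by
  obtain ⟨Φ, n, hn, hΦ⟩ := h.exists_algHom_eq_sum_mul (𝕜 := 𝕜) hodd
  rw [← hΦ, ← map_smul]
  refine (Pi.isUnit_iff.2 fun B => ?_).map Φ
  have hnB : n B ≠ 0 := fun h0 => Int.not_even_iff_odd.2 (hn B) (h0 ▸ Even.zero)
  exact isUnit_iff_ne_zero.2 (mul_ne_zero ha (Int.cast_ne_zero.2 hnB))

theorem isUnit_cliffordPencil (h : IsCliffordPair g e) (hodd : Odd (Fintype.card ι)) {a : 𝕜}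
    {x : ι → 𝕜} (hax : a ^ 2 ≠ ∑ i, x i ^ 2) : IsUnit (cliffordPencil g e a x) := by
  have hsum : 0 ≤ ∑ i, x i ^ 2 := Finset.sum_nonneg fun i _ => sq_nonneg (x i)
  rcases hsum.eq_or_lt with hx | hx
  · have ha : a ≠ 0 := fun ha => hax (by rw [ha, ← hx, zero_pow two_ne_zero])
    have hx0 : ∀ i, x i = 0 := by
      simpa [Finset.sum_eq_zero_iff_of_nonneg, sq_nonneg] using hx.symm
    simpa [cliffordPencil, hx0] using h.isUnit_smul_sum_mul hodd ha
  · refine h.isUnit_cliffordPencil_of_isUnit ?_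
    obtain ⟨Φ, n, hn, hΦ⟩ := h.exists_algHom_eq_sum_mul (𝕜 := 𝕜) hodd
    generalize ∑ i, x i ^ 2 = q at hax hx
    simp only [← hΦ, ← map_smul, ← map_pow, ← map_one Φ, ← map_add, ← map_sub]
    refine (Pi.isUnit_iff.2 fun B => ?_).map Φ
    have hfactor : q ^ 2 * ((a ^ 2 * (n B : 𝕜) ^ 2 + q * 1) ^ 2 - 4 * a ^ 4 * (n B : 𝕜) ^ 2) =
        q ^ 2 * ((a ^ 2 * (((n B - 1 : ℤ) : 𝕜) ^ 2 - 1) + q) *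
          (a ^ 2 * (((n B + 1 : ℤ) : 𝕜) ^ 2 - 1) + q)) := by
      push_cast
      ring
    refine isUnit_iff_ne_zero.2 (hfactor.trans_ne ?_)
    exact mul_ne_zero (pow_ne_zero 2 hx.ne') (mul_ne_zero
      (sq_mul_sq_sub_one_add_ne_zero hx hax ((hn B).sub_odd odd_one))
      (sq_mul_sq_sub_one_add_ne_zero hx hax ((hn B).add_odd odd_one)))

end Invertible

end IsCliffordPair

/-! ### Traces and multiplicities -/

section Fourier

variable {ι : Type*} [Fintype ι] [DecidableEq ι] {𝕜 : Type*} [Field 𝕜] [NeZero (2 : 𝕜)]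

theorem single_eq_smul_sum_prod_signCoord (B : Finset ι) :
    (Pi.single B 1 : Finset ι → 𝕜) =
      (2⁻¹ : 𝕜) ^ Fintype.card ι • ∑ C, (∏ i ∈ C, signCoord 𝕜 i B) • ∏ i ∈ C, signCoord 𝕜 i := by
  have hsum : (∑ C, (∏ i ∈ C, signCoord 𝕜 i B) • ∏ i ∈ C, signCoord 𝕜 i : Finset ι → 𝕜) =
      ∏ i, (1 + signCoord 𝕜 i B • signCoord 𝕜 i) := by
    simp only [Finset.prod_one_add, Finset.powerset_univ, Finset.prod_smul]
  funext C
  rw [hsum, Pi.smul_apply, Finset.prod_apply]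
  rcases eq_or_ne C B with rfl | hCB
  · have h (i : ι) : signCoord 𝕜 i C * signCoord 𝕜 i C = 1 :=
      congrFun (signCoord_mul_self i) C
    simp [h, one_add_one_eq_two, NeZero.ne (2 : 𝕜)]
  · obtain ⟨i, hi⟩ := exists_signCoord_ne (𝕜 := 𝕜) hCB
    have hneg : 1 + signCoord 𝕜 i B * signCoord 𝕜 i C = 0 := by
      by_cases hB : i ∈ B <;> by_cases hC : i ∈ C <;> simp_all [signCoord]
    rw [Pi.single_eq_of_ne hCB, Finset.prod_eq_zero (Finset.mem_univ i) (by simpa using hneg),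
      smul_zero]

theorem exists_odd_card_erase {B : Finset ι} (hB : B ≠ ∅) (hB' : B ≠ Finset.univ) :
    ∃ i, Odd (B.erase i).card := by
  rcases Nat.even_or_odd B.card with hcard | hcard
  · obtain ⟨i, hi⟩ := Finset.nonempty_iff_ne_empty.2 hB
    refine ⟨i, ?_⟩
    rw [Finset.card_erase_of_mem hi]
    exact Nat.Even.sub_odd (Finset.card_pos.2 ⟨i, hi⟩) hcard odd_one
  · obtain ⟨i, hi⟩ : ∃ i, i ∉ B := by
      simpa [Finset.eq_univ_iff_forall] using hB'
    exact ⟨i, by rwa [Finset.erase_eq_of_notMem hi]⟩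

end Fourier

theorem trace_eq_zero_of_anticomm {𝕜 A V : Type*} [Field 𝕜] [NeZero (2 : 𝕜)] [Ring A] [Algebra 𝕜 A]
    [AddCommGroup V] [Module 𝕜 V] (τ : A →ₗ[𝕜] V) (hτ : ∀ a b, τ (a * b) = τ (b * a)) {u q : A}
    (hu : u * u = 1) (huq : u * q = -(q * u)) : τ q = 0 := by
  have hneg : τ q = -τ q := calc
    τ q = τ (u * (u * q)) := by rw [← mul_assoc, hu, one_mul]
    _ = -τ (u * (q * u)) := by rw [huq, mul_neg, map_neg]
    _ = -τ q := by rw [hτ, mul_assoc, hu, mul_one]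
  rw [eq_neg_iff_add_eq_zero, ← two_smul 𝕜] at hneg
  exact (smul_eq_zero.1 hneg).resolve_left (NeZero.ne 2)

namespace IsCliffordPair

variable {ι A : Type*} [Ring A] {g e : ι → A} [DecidableEq ι] {𝕜 : Type*} [Field 𝕜]
  [Algebra 𝕜 A] {Φ : (Finset ι → 𝕜) →ₐ[𝕜] A}

theorem left_mul_map_prod_signCoord (h : IsCliffordPair g e)
    (hΦ : ∀ i, Φ (signCoord 𝕜 i) = g i * e i) (i : ι) (B : Finset ι) :
    g i * Φ (∏ j ∈ B, signCoord 𝕜 j) =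
      (-1) ^ (B.erase i).card * Φ (∏ j ∈ B, signCoord 𝕜 j) * g i := by
  induction B using Finset.induction_on with
  | empty => simp
  | insert j B hj ih =>
    rw [Finset.prod_insert hj, map_mul, hΦ, mul_assoc ((-1) ^ _)]
    rw [mul_assoc ((-1) ^ _)] at ih
    rcases eq_or_ne i j with rfl | hij
    · rw [← mul_assoc, h.left_mul_self, mul_assoc, ih, Finset.erase_insert hj,
        Finset.erase_eq_of_notMem hj]
      simp only [((Commute.neg_one_left _).pow_left _).left_comm, mul_assoc]
    · rw [← mul_assoc, h.left_mul_of_ne hij, neg_mul, mul_assoc, ih,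
        Finset.erase_insert_of_ne hij.symm, Finset.card_insert_of_notMem (by simp [hj]), pow_succ]
      simp only [((Commute.neg_one_left _).pow_left _).left_comm, mul_assoc, neg_mul, mul_neg,
        one_mul]

variable [Fintype ι] [NeZero (2 : 𝕜)] {V : Type*} [AddCommGroup V] [Module 𝕜 V]

theorem trace_map_prod_signCoord_eq_zero (h : IsCliffordPair g e)
    (hΦ : ∀ i, Φ (signCoord 𝕜 i) = g i * e i) (τ : A →ₗ[𝕜] V) (hτ : ∀ a b, τ (a * b) = τ (b * a))
    {B : Finset ι} (hB : B ≠ ∅) (hB' : B ≠ Finset.univ) : τ (Φ (∏ j ∈ B, signCoord 𝕜 j)) = 0 := by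
  obtain ⟨i, hi⟩ := exists_odd_card_erase hB hB'
  refine trace_eq_zero_of_anticomm τ hτ (h.left.mul_self i) ?_
  rw [h.left_mul_map_prod_signCoord hΦ, hi.neg_one_pow, neg_one_mul, neg_mul]

theorem trace_map_single [Nonempty ι] (h : IsCliffordPair g e)
    (hΦ : ∀ i, Φ (signCoord 𝕜 i) = g i * e i) {κ : 𝕜} (hκ : Φ (∏ i, signCoord 𝕜 i) = κ • 1)
    (τ : A →ₗ[𝕜] V) (hτ : ∀ a b, τ (a * b) = τ (b * a)) (B : Finset ι) :
    τ (Φ (Pi.single B 1)) =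
      (2⁻¹ ^ Fintype.card ι * (1 + κ * (-1) ^ B.card) : 𝕜) • τ 1 := by
  rw [single_eq_smul_sum_prod_signCoord, map_smul, map_smul, map_sum, map_sum,
    Finset.sum_eq_add ∅ Finset.univ Finset.univ_nonempty.ne_empty.symm
      (fun C _ hC => by
        rw [map_smul, map_smul, h.trace_map_prod_signCoord_eq_zero hΦ τ hτ hC.1 hC.2, smul_zero])
      (by simp) (by simp), map_smul, map_smul, map_smul, map_smul, hκ, ← prod_signCoord_apply,
    Finset.prod_apply]
  simp only [Finset.prod_empty, map_one, map_smul]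
  module

theorem trace_aeval_sum_mul [Nonempty ι] (h : IsCliffordPair g e)
    (hΦ : ∀ i, Φ (signCoord 𝕜 i) = g i * e i) {κ : 𝕜} (hκ : Φ (∏ i, signCoord 𝕜 i) = κ • 1)
    (τ : A →ₗ[𝕜] V) (hτ : ∀ a b, τ (a * b) = τ (b * a)) (p : Polynomial 𝕜) :
    τ (Polynomial.aeval (∑ i, g i * e i) p) =
      (2⁻¹ ^ Fintype.card ι * ∑ k ∈ Finset.range (Fintype.card ι + 1),
        (Fintype.card ι).choose k * ((1 + κ * (-1) ^ k) * p.eval (Fintype.card ι - 2 * k : 𝕜))) •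
          τ 1 := by
  have hS : ∑ i, g i * e i = Φ (∑ i, signCoord 𝕜 i) := by simp only [map_sum, hΦ]
  have hf (f : Finset ι → 𝕜) : f = ∑ B, f B • Pi.single B 1 := by
    simpa [← Pi.single_smul] using (Finset.univ_sum_single f).symm
  rw [hS, Polynomial.aeval_algHom_apply, hf (Polynomial.aeval _ p), map_sum, map_sum]
  simp only [map_smul, h.trace_map_single hΦ hκ τ hτ, smul_smul, ← Finset.sum_smul]
  congr 1
  have hsum := Finset.sum_powerset_apply_card (x := (Finset.univ : Finset ι))
    (fun k => (1 + κ * (-1) ^ k) * p.eval (Fintype.card ι - 2 * k : 𝕜))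
  rw [Finset.powerset_univ, Finset.card_univ] at hsum
  simp only [← nsmul_eq_mul, ← hsum, Finset.mul_sum]
  refine Finset.sum_congr rfl fun B _ => ?_
  rw [Polynomial.aeval_fn_apply, sum_signCoord_apply, Polynomial.coe_aeval_eq_eval]
  ring

end IsCliffordPair

/-! ### Signature of a Hermitian matrix -/

section HermitianMatrix

open scoped Matrix.Norms.L2Operator

variable {n 𝕜 : Type*} [Fintype n] [DecidableEq n] [RCLike 𝕜] {M : Matrix n n 𝕜}

theorem trace_cfc (hM : M.IsHermitian) (f : ℝ → ℝ) :
    (cfc f M).trace = ((∑ i, f (hM.eigenvalues i) : ℝ) : 𝕜) := by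
  rw [hM.cfc_eq, Matrix.IsHermitian.cfc, Unitary.conjStarAlgAut_apply, Matrix.trace_mul_cycle,
    Unitary.coe_star_mul_self, one_mul, Matrix.trace_diagonal]
  simp

theorem sum_eigenvalues_eq_of_trace_aeval (hM : M.IsHermitian) {J : Type*} {s : Finset J}
    {w y : J → ℝ}
    (h : ∀ p : Polynomial ℝ,
      (Polynomial.aeval M p).trace = ((∑ j ∈ s, w j * p.eval (y j) : ℝ) : 𝕜))
    (f : ℝ → ℝ) : ∑ i, f (hM.eigenvalues i) = ∑ j ∈ s, w j * f (y j) := by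
  let nodes : Finset ℝ := Finset.univ.image hM.eigenvalues ∪ s.image y
  let p : Polynomial ℝ := Lagrange.interpolate nodes id f
  have hp : ∀ t ∈ nodes, p.eval t = f t := fun t ht =>
    Lagrange.eval_interpolate_at_node f Function.injective_id.injOn ht
  have hpM := h p
  rw [← cfc_polynomial p M hM.isSelfAdjoint, trace_cfc hM, RCLike.ofReal_inj] at hpM
  calc ∑ i, f (hM.eigenvalues i) = ∑ i, p.eval (hM.eigenvalues i) :=
        Finset.sum_congr rfl fun i _ => (hp _ (by simp [nodes])).symm
    _ = ∑ j ∈ s, w j * p.eval (y j) := hpM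
    _ = ∑ j ∈ s, w j * f (y j) := Finset.sum_congr rfl fun j hj => by
        rw [hp _ (Finset.mem_union_right _ (Finset.mem_image_of_mem y hj))]

theorem eigenvalues_sq_of_mul_self (hM : M.IsHermitian) {b : ℝ}
    (h : M * M = b ^ 2 • (1 : Matrix n n 𝕜)) (i : n) : hM.eigenvalues i ^ 2 = b ^ 2 := by
  have : Nonempty n := ⟨i⟩
  have hi := spectrum.pow_mem_pow M 2 (hM.eigenvalues_mem_spectrum_real i)
  rwa [pow_two M, h, ← Algebra.algebraMap_eq_smul_one, spectrum.scalar_eq,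
    Set.mem_singleton_iff] at hi

end HermitianMatrix

section Signature

open scoped Matrix.Norms.L2Operator

variable {n : Type} [Fintype n] [DecidableEq n] {M : Matrix n n ℂ}

theorem signature_eq_sum_sign (hM : M.IsHermitian) :
    (signature M hM : ℝ) = ∑ i, (SignType.sign (hM.eigenvalues i) : ℝ) := by
  have hsign (y : ℝ) :
      (SignType.sign y : ℝ) = (if 0 < y then 1 else 0) - (if y < 0 then 1 else 0) := by
    rcases lt_trichotomy y 0 with h | h | h
    · simp [sign_neg h, h, h.not_gt]
    · simp [h]
    · simp [sign_pos h, h, h.not_gt]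
  rw [signature, Int.cast_sub, Int.cast_natCast, Int.cast_natCast]
  simp only [hsign, Finset.sum_sub_distrib, Finset.sum_boole]

theorem mul_signature_eq_trace (hM : M.IsHermitian) {b : ℝ} (hb : 0 < b)
    (h : M * M = b ^ 2 • (1 : Matrix n n ℂ)) : (b * signature M hM : ℂ) = M.trace := by
  have hsign (i : n) : b * (SignType.sign (hM.eigenvalues i) : ℝ) = hM.eigenvalues i := by
    rcases sq_eq_sq_iff_eq_or_eq_neg.1 (eigenvalues_sq_of_mul_self hM h i) with hi | hi
    · simp [hi, sign_pos hb]
    · simp [hi, Left.sign_neg, sign_pos hb]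
  have hsum : b * (signature M hM : ℝ) = ∑ i, hM.eigenvalues i := by
    rw [signature_eq_sum_sign, Finset.mul_sum, Finset.sum_congr rfl fun i _ => hsign i]
  rw [hM.trace_eq_sum_eigenvalues, ← RCLike.ofReal_sum, ← hsum]
  simp

/-- The signature is the trace of `sign L`, which is continuous in `L` as long as `L` stays
invertible. -/
theorem signature_eq_of_isPreconnected {X : Type*} [TopologicalSpace X] {s : Set X}
    (hs : IsPreconnected s) {L : X → Matrix n n ℂ} (hL : ∀ x, (L x).IsHermitian)
    (hcont : ContinuousOn L s) (hunit : ∀ x ∈ s, IsUnit (L x)) {x y : X} (hx : x ∈ s)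
    (hy : y ∈ s) : signature (L x) (hL x) = signature (L y) (hL y) := by
  have hspec : ({0}ᶜ : Set ℝ) ∈ nhdsSet (⋃ x ∈ s, spectrum ℝ (L x)) := by
    refine isOpen_compl_singleton.mem_nhdsSet.2 (Set.iUnion₂_subset fun x hx t ht => ?_)
    rintro rfl
    exact (spectrum.zero_notMem_iff ℝ).2 (hunit x hx) ht
  have hsign : ContinuousOn (fun t : ℝ => (SignType.sign t : ℝ)) {0}ᶜ := fun t ht =>
    ((continuous_of_discreteTopology (f := fun u : SignType => (u : ℝ))).continuousAt.comp
      (continuousAt_sign_of_ne_zero ht)).continuousWithinAt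
  have hcfc := ContinuousOn.cfc_of_mem_nhdsSet _ hspec hcont (fun x _ => (hL x).isSelfAdjoint) hsign
  have hint : ContinuousOn (fun x => signature (L x) (hL x)) s := by
    rw [Int.isClosedEmbedding_coe_real.isInducing.continuousOn_iff]
    refine ((Complex.continuous_re.comp continuous_id.matrix_trace).comp_continuousOn hcfc).congr
      fun x _ => ?_
    simp [trace_cfc (hL x), signature_eq_sum_sign (hL x)]
  exact hs.constant hint hx hy

end Signature

/-! ### Irreducible representations -/

theorem isCliffordSystem_gen (d : ℕ) : IsCliffordSystem (gen : Fin d → Cl d) :=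
  ⟨gen_sq, fun _ _ => gen_anticomm⟩

section Representations

variable {d n m : ℕ} {γ : Fin d → Matrix (Fin n) (Fin n) ℂ}

theorem IsCliffordRep.isCliffordSystem (hγ : IsCliffordRep γ) : IsCliffordSystem γ :=
  ⟨hγ.mul_self, hγ.anticomm⟩

theorem hasCliffordSign_iff {γ : Fin (d + 1) → Matrix (Fin n) (Fin n) ℂ}
    (hγ : IsCliffordSystem γ) (ε : ℂ) :
    HasCliffordSign γ ε ↔ (List.ofFn γ).prod = ε • 1 := by
  set l := List.ofFn fun i : Fin d => γ i.castSucc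
  have hsq : ∀ a ∈ l, a * a = 1 := by
    simpa [l, List.forall_mem_ofFn_iff] using fun i : Fin d => hγ.mul_self i.castSucc
  have hsplit : List.ofFn γ = l ++ [γ (Fin.last d)] := by
    rw [List.ofFn_succ', List.concat_eq_append]
  have hlast : HasCliffordSign γ ε ↔ γ (Fin.last d) = ε • l.reverse.prod := by
    rw [HasCliffordSign, hsplit, List.dropLast_concat]
    refine ⟨fun h => h _ (by simp), fun h j hj => ?_⟩
    rwa [show j = Fin.last d from Fin.ext (by simpa using hj)]
  let u : (Matrix (Fin n) (Fin n) ℂ)ˣ :=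
    ⟨l.prod, l.reverse.prod, list_prod_mul_reverse_prod hsq, by
      simpa using list_prod_mul_reverse_prod (l := l.reverse) (by simpa using hsq)⟩
  calc HasCliffordSign γ ε ↔ γ (Fin.last d) = ↑u⁻¹ * (ε • 1) := by
        rw [hlast, mul_smul_comm, mul_one]; rfl
    _ ↔ (List.ofFn γ).prod = ε • 1 := by
        rw [Units.eq_inv_mul_iff_mul_eq, hsplit, List.prod_append, List.prod_singleton]

namespace IsIrredCliffordRep

theorem exists_eq_smul_one (hγ : IsIrredCliffordRep γ) {X : Matrix (Fin n) (Fin n) ℂ}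
    (hX : ∀ j, Commute (γ j) X) : ∃ c : ℂ, X = c • 1 := by
  have : Nonempty (Fin n) := ⟨⟨0, hγ.pos⟩⟩
  obtain ⟨c, hc⟩ := Module.End.exists_eigenvalue (Matrix.toLin' X)
  have hW := hγ.irred (Module.End.eigenspace (Matrix.toLin' X) c) fun j v hv => by
    rw [Module.End.mem_eigenspace_iff, Matrix.toLin'_apply] at hv ⊢
    rw [Matrix.mulVec_mulVec, ← (hX j).eq, ← Matrix.mulVec_mulVec, hv, Matrix.mulVec_smul]
  refine ⟨c, Matrix.toLin'.injective (LinearMap.ext fun v => ?_)⟩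
  have hv : v ∈ Module.End.eigenspace (Matrix.toLin' X) c :=
    hW.resolve_left hc ▸ Submodule.mem_top
  rw [Module.End.mem_eigenspace_iff.1 hv]
  simp

theorem exists_hasCliffordSign {γ : Fin (2 * m + 1) → Matrix (Fin n) (Fin n) ℂ}
    (hγ : IsIrredCliffordRep γ) : ∃ ε : ℂ, HasCliffordSign γ ε := by
  obtain ⟨ε, hε⟩ := hγ.exists_eq_smul_one hγ.isCliffordSystem.commute_ofFn_prod
  exact ⟨ε, (hasCliffordSign_iff hγ.isCliffordSystem ε).2 hε⟩

theorem sign_mul_self {γ : Fin (2 * m + 1) → Matrix (Fin n) (Fin n) ℂ}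
    (hγ : IsIrredCliffordRep γ) {ε : ℂ} (hε : HasCliffordSign γ ε) : ε * ε = (-1) ^ m := by
  have : Nonempty (Fin n) := ⟨⟨0, hγ.pos⟩⟩
  have h := hγ.isCliffordSystem.ofFn_prod_mul_self
  rw [(hasCliffordSign_iff hγ.isCliffordSystem ε).1 hε, smul_mul_smul_comm, mul_one,
    ← Algebra.algebraMap_eq_smul_one, ← map_one (algebraMap ℂ _), ← map_neg, ← map_pow] at h
  exact (algebraMap ℂ (Matrix (Fin n) (Fin n) ℂ)).injective h

end IsIrredCliffordRep

end Representations

section Dimension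

variable {d n m : ℕ} {γ : Fin d → Matrix (Fin n) (Fin n) ℂ}
  {Φ : (Finset (Fin d) → ℂ) →ₐ[ℂ] Module.End ℂ (Matrix (Fin n) (Fin n) ℂ)}

theorem map_prod_signCoord_apply_one (hγ : IsCliffordSystem γ)
    (hΦ : ∀ j, Φ (signCoord ℂ j) = LinearMap.mulLeft ℂ (γ j) * LinearMap.mulRight ℂ (γ j))
    (C : Finset (Fin d)) : Φ (∏ j ∈ C, signCoord ℂ j) 1 = 1 := by
  induction C using Finset.induction_on with
  | empty => simp
  | insert j C hj ih =>
    rw [Finset.prod_insert hj, map_mul, Module.End.mul_apply, ih, hΦ, Module.End.mul_apply,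
      LinearMap.mulRight_apply, LinearMap.mulLeft_apply, one_mul, hγ.mul_self]

theorem map_single_empty_apply_one (hγ : IsCliffordSystem γ)
    (hΦ : ∀ j, Φ (signCoord ℂ j) = LinearMap.mulLeft ℂ (γ j) * LinearMap.mulRight ℂ (γ j)) :
    Φ (Pi.single ∅ 1) 1 = 1 := by
  rw [single_eq_smul_sum_prod_signCoord, map_smul, map_sum, LinearMap.smul_apply,
    LinearMap.sum_apply]
  simp [map_prod_signCoord_apply_one hγ hΦ, signCoord, smul_smul,
    ← Nat.cast_smul_eq_nsmul ℂ]

theorem commute_map_single_empty_apply (hγ : IsCliffordSystem γ)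
    (hΦ : ∀ j, Φ (signCoord ℂ j) = LinearMap.mulLeft ℂ (γ j) * LinearMap.mulRight ℂ (γ j))
    (j : Fin d) (X : Matrix (Fin n) (Fin n) ℂ) : Commute (γ j) (Φ (Pi.single ∅ 1) X) := by
  have hfix : γ j * (Φ (Pi.single ∅ 1) X * γ j) = Φ (Pi.single ∅ 1) X := calc
    _ = Φ (signCoord ℂ j * Pi.single ∅ 1) X := by
      rw [map_mul, hΦ]
      rfl
    _ = Φ (Pi.single ∅ 1) X := by
      rw [← Pi.single_mul_right, signCoord]
      simp
  calc γ j * Φ (Pi.single ∅ 1) X = γ j * (γ j * (Φ (Pi.single ∅ 1) X * γ j)) := by rw [hfix]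
    _ = Φ (Pi.single ∅ 1) X * γ j := by rw [← mul_assoc, hγ.mul_self, one_mul]

theorem isProj_map_single_empty (hγ : IsIrredCliffordRep γ)
    (hΦ : ∀ j, Φ (signCoord ℂ j) = LinearMap.mulLeft ℂ (γ j) * LinearMap.mulRight ℂ (γ j)) :
    LinearMap.IsProj (Submodule.span ℂ {(1 : Matrix (Fin n) (Fin n) ℂ)}) (Φ (Pi.single ∅ 1)) := by
  refine ⟨fun X => ?_, fun X hX => ?_⟩
  · obtain ⟨c, hc⟩ := hγ.exists_eq_smul_one fun j =>
      commute_map_single_empty_apply hγ.isCliffordSystem hΦ j X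
    exact hc ▸ Submodule.smul_mem _ c (Submodule.mem_span_singleton_self _)
  · obtain ⟨c, rfl⟩ := Submodule.mem_span_singleton.1 hX
    rw [map_smul, map_single_empty_apply_one hγ.isCliffordSystem hΦ]

/-- The rank of the projection of the matrix algebra onto the scalars is one, and its trace is a
fixed multiple of `n ^ 2`. -/
theorem IsIrredCliffordRep.dim_mul_self {γ : Fin (2 * m + 1) → Matrix (Fin n) (Fin n) ℂ}
    (hγ : IsIrredCliffordRep γ) : n * n = 2 ^ (2 * m) := by
  have : Nonempty (Fin n) := ⟨⟨0, hγ.pos⟩⟩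
  have h := hγ.isCliffordSystem.isCliffordPair_mulLeft_mulRight (𝕜 := ℂ)
  obtain ⟨Φ, hΦ⟩ := h.exists_algHom_signCoord (𝕜 := ℂ)
  obtain ⟨ε, hε⟩ := hγ.exists_hasCliffordSign
  rw [hasCliffordSign_iff hγ.isCliffordSystem] at hε
  have hκ : Φ (∏ j, signCoord ℂ j) = (1 : ℂ) • 1 := by
    ext1 X
    have hrev : (List.ofFn γ).prod * (List.ofFn γ).reverse.prod = 1 :=
      list_prod_mul_reverse_prod <| (List.forall_mem_ofFn_iff).2 hγ.mul_self
    have hX := list_prod_mulLeft_mul_mulRight_apply (R := ℂ) (List.ofFn γ) X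
    rw [List.map_ofFn] at hX
    rw [map_prod_signCoord hΦ]
    refine hX.trans ?_
    rw [hε, smul_mul_assoc, one_mul] at hrev ⊢
    rw [smul_mul_assoc, ← mul_smul_comm, hrev, mul_one, one_smul, Module.End.one_apply]
  have htrace := h.trace_map_single hΦ hκ (LinearMap.trace ℂ _) (LinearMap.trace_mul_comm ℂ) ∅
  rw [(isProj_map_single_empty hγ hΦ).trace, finrank_span_singleton one_ne_zero,
    LinearMap.trace_one, Module.finrank_matrix, Fintype.card_fin, Fintype.card_fin] at htrace
  have hn : (1 : ℂ) = 2⁻¹ ^ (2 * m) * (n * n) := by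
    simpa [pow_succ, one_add_one_eq_two] using htrace
  rw [inv_pow, eq_inv_mul_iff_mul_eq₀ (by simp), mul_one] at hn
  exact_mod_cast hn.symm

end Dimension

/-! ### Localizers -/

section Localizer

variable {d n r : ℕ}

theorem IsCliffordSystem.isCliffordPair_kronecker {ι n r R : Type*} [Fintype n] [DecidableEq n]
    [Fintype r] [DecidableEq r] [CommRing R] {γ : ι → Matrix n n R} {ρ : ι → Matrix r r R}
    (hγ : IsCliffordSystem γ) (hρ : IsCliffordSystem ρ) :
    IsCliffordPair (fun j => γ j ⊗ₖ (1 : Matrix r r R)) (fun j => (1 : Matrix n n R) ⊗ₖ ρ j) :=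
  (hγ.isCliffordPair_tmul (𝕜 := R) hρ).map (Matrix.kroneckerAlgEquiv n r R).toRingEquiv.toRingHom

theorem IsCliffordSystem.one_kronecker {ι r R : Type*} (n : Type*) [Fintype n] [DecidableEq n]
    [Fintype r] [DecidableEq r] [CommRing R] {ρ : ι → Matrix r r R} (hρ : IsCliffordSystem ρ) :
    IsCliffordSystem fun j => (1 : Matrix n n R) ⊗ₖ ρ j :=
  (hρ.map (Algebra.TensorProduct.includeRight : _ →ₐ[R] Matrix n n R ⊗[R] _).toRingHom).map
    (Matrix.kroneckerAlgEquiv n r R).toRingEquiv.toRingHom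

theorem localizer_smul_eq_cliffordPencil (ρ : Fin d → Matrix (Fin r) (Fin r) ℂ)
    (A : Fin d → Matrix (Fin n) (Fin n) ℂ) (a : ℝ) (x : EuclideanSpace ℝ (Fin d)) :
    localizer ρ (a • A) x =
      cliffordPencil (fun j => A j ⊗ₖ (1 : Matrix (Fin r) (Fin r) ℂ))
        (fun j => (1 : Matrix (Fin n) (Fin n) ℂ) ⊗ₖ ρ j) a x := by
  rw [localizer, cliffordPencil, Finset.smul_sum, ← Finset.sum_sub_distrib]
  refine Finset.sum_congr rfl fun j _ => ?_
  rw [← Matrix.mul_kronecker_mul, mul_one, one_mul]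
  ext
  simp [Matrix.kroneckerMap_apply, sub_mul, mul_assoc]

theorem universalLocalizer_eq_cliffordPencil (A : Fin d → Matrix (Fin n) (Fin n) ℂ)
    (x : EuclideanSpace ℝ (Fin d)) :
    universalLocalizer A x = cliffordPencil (fun j => A j ⊗ₜ[ℂ] (1 : Cl d))
      (fun j => (1 : Matrix (Fin n) (Fin n) ℂ) ⊗ₜ[ℂ] (gen j : Cl d)) (1 : ℝ) x := by
  rw [universalLocalizer, cliffordPencil, one_smul, ← Finset.sum_sub_distrib]
  refine Finset.sum_congr rfl fun j _ => ?_
  rw [Algebra.TensorProduct.tmul_mul_tmul, mul_one, one_mul, TensorProduct.sub_tmul,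
    TensorProduct.smul_tmul']
  rfl

theorem IsCliffordSystem.exists_algHom_gen {A : Type*} [Ring A] [Algebra ℂ A] {e : Fin d → A}
    (he : IsCliffordSystem e) : ∃ φ : Cl d →ₐ[ℂ] A, ∀ j, φ (gen j) = e j := by
  refine ⟨CliffordAlgebra.lift (stdForm d) ⟨Fintype.linearCombination ℂ e, fun c => ?_⟩,
    fun j => ?_⟩
  · rw [Fintype.linearCombination_apply, he.sum_smul_mul_self, Algebra.algebraMap_eq_smul_one]
    simp [stdForm, QuadraticMap.weightedSumSquares_apply, pow_two]
  · rw [gen, CliffordAlgebra.lift_ι_apply, Fintype.linearCombination_apply_single, one_smul]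

theorem isUnit_localizer_of_isUnit_universalLocalizer {A : Fin d → Matrix (Fin n) (Fin n) ℂ}
    {ρ : Fin d → Matrix (Fin r) (Fin r) ℂ} (hρ : IsCliffordSystem ρ)
    {x : EuclideanSpace ℝ (Fin d)} (h : IsUnit (universalLocalizer A x)) :
    IsUnit (localizer ρ A x) := by
  obtain ⟨φ, hφ⟩ := hρ.exists_algHom_gen
  convert (h.map (Algebra.TensorProduct.map (AlgHom.id ℂ (Matrix (Fin n) (Fin n) ℂ)) φ)).map
    (Matrix.kroneckerAlgEquiv (Fin n) (Fin r) ℂ) using 1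
  simp only [universalLocalizer, localizer, map_sum, Algebra.TensorProduct.map_tmul, hφ]
  rfl

theorem continuous_localizer_smul (ρ : Fin d → Matrix (Fin r) (Fin r) ℂ)
    (A : Fin d → Matrix (Fin n) (Fin n) ℂ) :
    Continuous fun p : ℝ × EuclideanSpace ℝ (Fin d) => localizer ρ (p.1 • A) p.2 := by
  simp only [localizer_smul_eq_cliffordPencil, cliffordPencil]
  fun_prop

theorem continuous_localizer (ρ : Fin d → Matrix (Fin r) (Fin r) ℂ)
    (A : Fin d → Matrix (Fin n) (Fin n) ℂ) : Continuous (localizer ρ A) := by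
  simpa only [Function.comp_def, one_smul] using
    (continuous_localizer_smul ρ A).comp (Continuous.prodMk_right (1 : ℝ))

variable {γ : Fin d → Matrix (Fin n) (Fin n) ℂ} {ρ : Fin d → Matrix (Fin r) (Fin r) ℂ}

theorem isUnit_localizer_smul (hγ : IsCliffordSystem γ) (hρ : IsCliffordSystem ρ) (hd : Odd d)
    {a : ℝ} {x : EuclideanSpace ℝ (Fin d)} (hax : a ^ 2 ≠ ‖x‖ ^ 2) :
    IsUnit (localizer ρ (a • γ) x) := by
  rw [localizer_smul_eq_cliffordPencil]
  refine (hγ.isCliffordPair_kronecker hρ).isUnit_cliffordPencil (by rwa [Fintype.card_fin]) ?_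
  rwa [← EuclideanSpace.real_norm_sq_eq]

theorem localizer_smul_isHermitian (hγ : ∀ j, (γ j).IsHermitian) (hρ : ∀ j, (ρ j).IsHermitian)
    (a : ℝ) (x : EuclideanSpace ℝ (Fin d)) : (localizer ρ (a • γ) x).IsHermitian :=
  localizer_isHermitian hρ (fun j => (hγ j).smul (IsSelfAdjoint.all a)) x

end Localizer

section BinomialSum

theorem sum_mul_sign_eq_sum_sub (m : ℕ) (c : ℕ → ℝ) :
    ∑ k ∈ Finset.range (2 * m + 1 + 1), c k * (SignType.sign ((2 * m + 1 : ℕ) - 2 * k : ℝ) : ℝ) =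
      ∑ k ∈ Finset.range (m + 1), (c k - c (2 * m + 1 - k)) := by
  have hreflect : ∑ k ∈ Finset.range (m + 1), c (m + 1 + k) =
      ∑ k ∈ Finset.range (m + 1), c (2 * m + 1 - k) := by
    rw [← Finset.sum_range_reflect (fun k => c (m + 1 + k))]
    refine Finset.sum_congr rfl fun k hk => congrArg c ?_
    have := Finset.mem_range.1 hk
    omega
  rw [show 2 * m + 1 + 1 = m + 1 + (m + 1) by ring, Finset.sum_range_add, Finset.sum_sub_distrib,
    ← hreflect, sub_eq_add_neg, ← Finset.sum_neg_distrib]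
  congr 1 <;> refine Finset.sum_congr rfl fun k hk => ?_
  · have hk' : (k : ℝ) ≤ m := by exact_mod_cast Nat.lt_succ_iff.1 (Finset.mem_range.1 hk)
    rw [sign_pos (by push_cast; linarith [hk']), SignType.coe_one, mul_one]
  · have hk' : (0 : ℝ) ≤ k := Nat.cast_nonneg k
    rw [sign_neg (by push_cast; linarith [hk']), SignType.coe_neg_one, mul_neg_one]

theorem sum_choose_mul_sign (m : ℕ) :
    ∑ k ∈ Finset.range (2 * m + 1 + 1), ((2 * m + 1).choose k * (1 + (-1) ^ m * (-1) ^ k)) *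
        (SignType.sign ((2 * m + 1 : ℕ) - 2 * k : ℝ) : ℝ) = 2 * (2 * m).choose m := by
  have hpair : ∀ k ∈ Finset.range (m + 1),
      ((2 * m + 1).choose k * (1 + (-1) ^ m * (-1) ^ k) : ℝ) -
          (2 * m + 1).choose (2 * m + 1 - k) * (1 + (-1) ^ m * (-1) ^ (2 * m + 1 - k)) =
        2 * (-1) ^ m * ((-1) ^ k * (2 * m + 1).choose k) := fun k hk => by
    have hk' : k ≤ 2 * m + 1 := by linarith [Finset.mem_range.1 hk]
    have hparity : (-1 : ℝ) ^ (2 * m + 1 - k) = -(-1) ^ k := by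
      rw [← mul_right_inj' (pow_ne_zero k (neg_ne_zero.2 (one_ne_zero (α := ℝ)))), ← pow_add,
        Nat.add_sub_cancel' hk', mul_neg, ← pow_add, (odd_two_mul_add_one m).neg_one_pow,
        (Even.add_self k).neg_one_pow]
    rw [Nat.choose_symm hk', hparity]
    ring
  have halt : ∑ k ∈ Finset.range (m + 1), ((-1) ^ k * (2 * m + 1).choose k : ℝ) =
      (-1) ^ m * (2 * m).choose m := by
    exact_mod_cast Int.alternating_sum_range_choose_eq_choose (n := 2 * m) (m := m)
  rw [sum_mul_sign_eq_sum_sub m fun k => (2 * m + 1).choose k * (1 + (-1) ^ m * (-1) ^ k),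
    Finset.sum_congr rfl hpair, ← Finset.mul_sum, halt, mul_assoc, ← mul_assoc ((-1) ^ m),
    ← pow_add, (Even.add_self m).neg_one_pow, one_mul]

end BinomialSum

theorem list_prod_map_kronecker {ι n r R : Type*} [Fintype n] [DecidableEq n] [Fintype r]
    [DecidableEq r] [CommSemiring R] (γ : ι → Matrix n n R) (ρ : ι → Matrix r r R) (l : List ι) :
    (l.map fun i => γ i ⊗ₖ ρ i).prod = (l.map γ).prod ⊗ₖ (l.map ρ).prod := by
  induction l with
  | nil => simp
  | cons i l ih => simp [ih, Matrix.mul_kronecker_mul]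

section SignatureAtZero

variable {m n r : ℕ} {γ : Fin (2 * m + 1) → Matrix (Fin n) (Fin n) ℂ}
  {ρ : Fin (2 * m + 1) → Matrix (Fin r) (Fin r) ℂ} {ε : ℂ}

theorem ofFn_prod_kronecker (hγ : IsIrredCliffordRep γ) (hρ : IsCliffordSystem ρ)
    (hγε : HasCliffordSign γ ε) (hρε : HasCliffordSign ρ ε) :
    (List.ofFn fun j => γ j ⊗ₖ ρ j).prod = ((-1) ^ m : ℝ) • (1 : Matrix _ _ ℂ) := by
  rw [List.ofFn_eq_map, list_prod_map_kronecker, ← List.ofFn_eq_map, ← List.ofFn_eq_map,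
    (hasCliffordSign_iff hγ.isCliffordSystem ε).1 hγε, (hasCliffordSign_iff hρ ε).1 hρε,
    Matrix.smul_kronecker, Matrix.kronecker_smul, smul_smul, Matrix.one_kronecker_one,
    hγ.sign_mul_self hγε, ← Complex.coe_smul]
  push_cast
  rfl

theorem trace_aeval_localizer_zero (hγ : IsIrredCliffordRep γ) (hρ : IsIrredCliffordRep ρ)
    (hγε : HasCliffordSign γ ε) (hρε : HasCliffordSign ρ ε) (p : Polynomial ℝ) :
    (Polynomial.aeval (localizer ρ γ 0) p).trace =
      ((∑ k ∈ Finset.range (2 * m + 1 + 1), (2⁻¹ * ((2 * m + 1).choose k *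
        (1 + (-1) ^ m * (-1) ^ k))) * p.eval ((2 * m + 1 : ℕ) - 2 * k : ℝ) : ℝ) : ℂ) := by
  have h := hγ.isCliffordSystem.isCliffordPair_kronecker hρ.isCliffordSystem
  obtain ⟨Φ, hΦ⟩ := h.exists_algHom_signCoord (𝕜 := ℝ)
  have hκ : Φ (∏ j, signCoord ℝ j) = ((-1) ^ m : ℝ) • 1 := by
    rw [map_prod_signCoord hΦ]
    simp only [← Matrix.mul_kronecker_mul, mul_one, one_mul]
    exact ofFn_prod_kronecker hγ hρ.isCliffordSystem hγε hρε
  have hL : localizer ρ γ 0 = ∑ j, γ j ⊗ₖ 1 * 1 ⊗ₖ ρ j := by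
    simp [localizer, ← Matrix.mul_kronecker_mul]
  have hnr : n = r := Nat.mul_self_inj.1 (hγ.dim_mul_self.trans hρ.dim_mul_self.symm)
  have hone : (1 : Matrix (Fin n × Fin r) (Fin n × Fin r) ℂ).trace = ((2 ^ (2 * m) : ℝ) : ℂ) := by
    rw [Matrix.trace_one, Fintype.card_prod, Fintype.card_fin, Fintype.card_fin, ← hnr,
      hγ.dim_mul_self]
    push_cast
    rfl
  have ht := h.trace_aeval_sum_mul hΦ hκ (Matrix.traceLinearMap _ ℝ ℂ) Matrix.trace_mul_comm p
  rw [Matrix.traceLinearMap_apply, Matrix.traceLinearMap_apply, ← hL, hone, Complex.real_smul,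
    ← Complex.ofReal_mul, Fintype.card_fin, mul_right_comm, Finset.mul_sum] at ht
  rw [ht]
  have hpow : (2⁻¹ : ℝ) ^ (2 * m + 1) * 2 ^ (2 * m) = 2⁻¹ := by
    rw [pow_succ, mul_right_comm, ← mul_pow, inv_mul_cancel₀ two_ne_zero, one_pow, one_mul]
  simp only [hpow, mul_assoc]

theorem signature_localizer_zero (hγ : IsIrredCliffordRep γ) (hρ : IsIrredCliffordRep ρ)
    (hγε : HasCliffordSign γ ε) (hρε : HasCliffordSign ρ ε) (hL : (localizer ρ γ 0).IsHermitian) :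
    signature (localizer ρ γ 0) hL = ((2 * m).choose m : ℤ) := by
  have h := sum_eigenvalues_eq_of_trace_aeval hL (s := Finset.range (2 * m + 1 + 1))
    (trace_aeval_localizer_zero hγ hρ hγε hρε)
    fun t => (SignType.sign t : ℝ)
  simp only [mul_assoc (2⁻¹ : ℝ), ← Finset.mul_sum] at h
  rw [← signature_eq_sum_sign, sum_choose_mul_sign, inv_mul_cancel_left₀ two_ne_zero] at h
  exact_mod_cast h

end SignatureAtZero

section SignatureAtInfinity

theorem localizer_zero_left {d n r : ℕ} (ρ : Fin d → Matrix (Fin r) (Fin r) ℂ)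
    (x : EuclideanSpace ℝ (Fin d)) :
    localizer ρ (0 : Fin d → Matrix (Fin n) (Fin n) ℂ) x =
      ∑ j, -x j • (1 : Matrix (Fin n) (Fin n) ℂ) ⊗ₖ ρ j := by
  refine Finset.sum_congr rfl fun j _ => ?_
  ext
  simp [mul_assoc]

theorem signature_localizer_zero_left {d n r : ℕ} [Nontrivial (Fin d)]
    {ρ : Fin d → Matrix (Fin r) (Fin r) ℂ} (hρ : IsCliffordSystem ρ)
    {x : EuclideanSpace ℝ (Fin d)} (hx : x ≠ 0)
    (hL : (localizer ρ (0 : Fin d → Matrix (Fin n) (Fin n) ℂ) x).IsHermitian) :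
    signature (localizer ρ (0 : Fin d → Matrix (Fin n) (Fin n) ℂ) x) hL = 0 := by
  have hsys := hρ.one_kronecker (Fin n)
  have hsq : localizer ρ 0 x * localizer ρ 0 x =
      ‖x‖ ^ 2 • (1 : Matrix (Fin n × Fin r) (Fin n × Fin r) ℂ) := by
    rw [localizer_zero_left, hsys.sum_smul_mul_self, EuclideanSpace.real_norm_sq_eq]
    simp only [neg_sq]
  have htrace : (localizer ρ (0 : Fin d → Matrix (Fin n) (Fin n) ℂ) x).trace = 0 := by
    rw [localizer_zero_left, Matrix.trace_sum]
    refine Finset.sum_eq_zero fun j _ => ?_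
    obtain ⟨i, hi⟩ := exists_ne j
    rw [Matrix.trace_smul]
    exact smul_eq_zero_of_right _ (trace_eq_zero_of_anticomm (Matrix.traceLinearMap _ ℂ ℂ)
      Matrix.trace_mul_comm (hsys.mul_self i) (hsys.anticomm i j hi))
  have h := mul_signature_eq_trace hL (norm_pos_iff.2 hx) hsq
  simpa [htrace, hx] using h

end SignatureAtInfinity

section OddDimension

variable {m n r : ℕ} {γ : Fin (2 * m + 1) → Matrix (Fin n) (Fin n) ℂ}
  {ρ : Fin (2 * m + 1) → Matrix (Fin r) (Fin r) ℂ} {ε : ℂ} {x : EuclideanSpace ℝ (Fin (2 * m + 1))}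

theorem signature_localizer_of_norm_lt_one (hγ : IsIrredCliffordRep γ) (hρ : IsIrredCliffordRep ρ)
    (hγε : HasCliffordSign γ ε) (hρε : HasCliffordSign ρ ε) (hx : ‖x‖ < 1)
    (hL : (localizer ρ γ x).IsHermitian) :
    signature (localizer ρ γ x) hL = ((2 * m).choose m : ℤ) := by
  have hunit : ∀ y ∈ Metric.ball (0 : EuclideanSpace ℝ (Fin (2 * m + 1))) 1,
      IsUnit (localizer ρ γ y) := fun y hy => by
    have hy' : (1 : ℝ) ^ 2 ≠ ‖y‖ ^ 2 :=
      (pow_lt_pow_left₀ (mem_ball_zero_iff.1 hy) (norm_nonneg y) two_ne_zero).ne'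
    simpa only [one_smul] using isUnit_localizer_smul hγ.isCliffordSystem hρ.isCliffordSystem
      (odd_two_mul_add_one m) hy'
  rw [signature_eq_of_isPreconnected (convex_ball 0 1).isPreconnected
    (localizer_isHermitian hρ.isHermitian hγ.isHermitian)
    (continuous_localizer ρ γ).continuousOn hunit
    (mem_ball_zero_iff.2 hx) (Metric.mem_ball_self one_pos)]
  exact signature_localizer_zero hγ hρ hγε hρε _

theorem signature_localizer_of_one_lt_norm (hm : 0 < m) (hγ : IsCliffordRep γ)
    (hρ : IsCliffordRep ρ) (hx : 1 < ‖x‖) (hL : (localizer ρ γ x).IsHermitian) :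
    signature (localizer ρ γ x) hL = 0 := by
  have : Nontrivial (Fin (2 * m + 1)) := Fin.nontrivial_iff_two_le.2 (by omega)
  have hunit : ∀ a ∈ Set.Icc (0 : ℝ) 1, IsUnit (localizer ρ (a • γ) x) := fun a ha =>
    isUnit_localizer_smul hγ.isCliffordSystem hρ.isCliffordSystem (odd_two_mul_add_one m)
      (pow_lt_pow_left₀ (ha.2.trans_lt hx) ha.1 two_ne_zero).ne
  have h := signature_eq_of_isPreconnected isPreconnected_Icc
    (fun a => localizer_smul_isHermitian hγ.isHermitian hρ.isHermitian a x)
    ((continuous_localizer_smul ρ γ).comp (Continuous.prodMk_left x)).continuousOn hunit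
    (Set.right_mem_Icc.2 zero_le_one) (Set.left_mem_Icc.2 zero_le_one)
  simp only [one_smul, zero_smul] at h
  exact h.trans (signature_localizer_zero_left hρ.isCliffordSystem
    (norm_pos_iff.1 (one_pos.trans hx)) _)

theorem not_isUnit_localizer (hm : 0 < m) (hγ : IsIrredCliffordRep γ) (hx : ‖x‖ = 1) :
    ¬IsUnit (localizer γ γ x) := by
  intro hu
  have hunit : ∀ t ∈ Set.Ici (0 : ℝ), IsUnit (localizer γ γ (t • x)) := fun t ht => by
    rcases eq_or_ne t 1 with rfl | ht1
    · rwa [one_smul]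
    · have hnorm : (1 : ℝ) ^ 2 ≠ ‖t • x‖ ^ 2 := by
        rw [norm_smul, hx, mul_one, Real.norm_of_nonneg ht, one_pow]
        exact Ne.symm (mt (pow_eq_one_iff_of_nonneg ht two_ne_zero).1 ht1)
      simpa only [one_smul] using isUnit_localizer_smul hγ.isCliffordSystem hγ.isCliffordSystem
        (odd_two_mul_add_one m) hnorm
  have h := signature_eq_of_isPreconnected isPreconnected_Ici
    (fun t : ℝ => localizer_isHermitian hγ.isHermitian hγ.isHermitian (t • x))
    ((continuous_localizer γ γ).comp (continuous_id.smul continuous_const)).continuousOn hunit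
    (Set.mem_Ici.2 le_rfl) (Set.mem_Ici.2 zero_le_two)
  have houter : 1 < ‖(2 : ℝ) • x‖ := by simp [norm_smul, hx]
  obtain ⟨ε, hε⟩ := hγ.exists_hasCliffordSign
  rw [signature_localizer_of_one_lt_norm hm hγ.toIsCliffordRep hγ.toIsCliffordRep houter,
    signature_localizer_of_norm_lt_one hγ hγ hε hε (by simp)] at h
  exact (Nat.choose_pos (by omega : m ≤ 2 * m)).ne' (by exact_mod_cast h)

theorem cliffordSpectrum_eq_sphere (hm : 0 < m) (hγ : IsIrredCliffordRep γ) :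
    cliffordSpectrum γ = Metric.sphere (0 : EuclideanSpace ℝ (Fin (2 * m + 1))) 1 := by
  ext x
  rw [mem_sphere_zero_iff_norm, cliffordSpectrum, Set.mem_ofPred_eq]
  refine ⟨fun h => ?_, fun hx h => not_isUnit_localizer hm hγ hx
    (isUnit_localizer_of_isUnit_universalLocalizer hγ.isCliffordSystem h)⟩
  contrapose! h
  rw [universalLocalizer_eq_cliffordPencil]
  refine (hγ.isCliffordSystem.isCliffordPair_tmul
    (isCliffordSystem_gen _)).isUnit_cliffordPencil ?_ ?_
  · simp
  · rw [← EuclideanSpace.real_norm_sq_eq, one_pow]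
    exact Ne.symm (mt (pow_eq_one_iff_of_nonneg (norm_nonneg x) two_ne_zero).1 h)

end OddDimension

end CliffordSpec

theorem mainTheorem1 (d : ℕ) (hd : 3 ≤ d) (hodd : Odd d) (n : ℕ)
    (γ : Fin d → Matrix (Fin n) (Fin n) ℂ) (hγ : CliffordSpec.IsIrredCliffordRep γ) :
    -- the Clifford spectrum is the unit sphere
    CliffordSpec.cliffordSpectrum γ = Metric.sphere (0 : EuclideanSpace ℝ (Fin d)) 1 ∧
    -- the signature of the localizer, formed with `γ` itself
    (∀ x : EuclideanSpace ℝ (Fin d),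
      (‖x‖ < 1 → CliffordSpec.signature (CliffordSpec.localizer γ γ x)
          (CliffordSpec.localizer_isHermitian hγ.isHermitian hγ.isHermitian x) =
            (Nat.choose (d - 1) ((d - 1) / 2) : ℤ)) ∧
      (1 < ‖x‖ → CliffordSpec.signature (CliffordSpec.localizer γ γ x)
          (CliffordSpec.localizer_isHermitian hγ.isHermitian hγ.isHermitian x) = 0)) ∧
    -- the signature of the localizer, formed with an irreducible representation of the same sign
    (∀ (r : ℕ) (ρ : Fin d → Matrix (Fin r) (Fin r) ℂ) (hρ : CliffordSpec.IsIrredCliffordRep ρ)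
      (ε : ℂ), CliffordSpec.HasCliffordSign γ ε → CliffordSpec.HasCliffordSign ρ ε →
      ∀ x : EuclideanSpace ℝ (Fin d),
        (‖x‖ < 1 → CliffordSpec.signature (CliffordSpec.localizer ρ γ x)
            (CliffordSpec.localizer_isHermitian hρ.isHermitian hγ.isHermitian x) =
              (Nat.choose (d - 1) ((d - 1) / 2) : ℤ)) ∧
        (1 < ‖x‖ → CliffordSpec.signature (CliffordSpec.localizer ρ γ x)
            (CliffordSpec.localizer_isHermitian hρ.isHermitian hγ.isHermitian x) = 0)) := by
  obtain ⟨m, rfl⟩ := hodd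
  have hm : 0 < m := by omega
  have hsub : 2 * m + 1 - 1 = 2 * m := by omega
  have hdiv : 2 * m / 2 = m := by omega
  simp only [hsub, hdiv]
  have hsig {r : ℕ} {ρ : Fin (2 * m + 1) → Matrix (Fin r) (Fin r) ℂ}
      (hρ : CliffordSpec.IsIrredCliffordRep ρ) {ε : ℂ} (hγε : CliffordSpec.HasCliffordSign γ ε)
      (hρε : CliffordSpec.HasCliffordSign ρ ε) (x : EuclideanSpace ℝ (Fin (2 * m + 1))) :=
    And.intro
      (fun hx => CliffordSpec.signature_localizer_of_norm_lt_one hγ hρ hγε hρε (x := x) hx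
        (CliffordSpec.localizer_isHermitian hρ.isHermitian hγ.isHermitian x))
      (fun hx => CliffordSpec.signature_localizer_of_one_lt_norm hm hγ.toIsCliffordRep
        hρ.toIsCliffordRep (x := x) hx
        (CliffordSpec.localizer_isHermitian hρ.isHermitian hγ.isHermitian x))
  obtain ⟨ε, hε⟩ := hγ.exists_hasCliffordSign
  exact ⟨CliffordSpec.cliffordSpectrum_eq_sphere hm hγ, hsig hγ hε hε,
    fun r ρ hρ ε hγε hρε => hsig hρ hγε hρε⟩
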